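/- **Definitions.** Let $\Delta$ be the category of finite non-empty ordinals $\Delta^n=\{0<\dots<n\}$ and monotone maps. Let $\mathcal A$ be the full subcategory of $\prod_{n\ge 1}\Delta$ on the sequences $A=(A_1,A_2,\dots)$ with only finitely many components different from $\Delta^0$. For a morphism $f$ of $\mathcal A$ let $\deg f$ be the smallest $k\ge 1$ such that $f_k$ is constant (factors through $\Delta^0$); for parallel morphisms write $f\sim g$ if $\deg f=\deg g=:d$ and $f_1=g_1,\dots,f_d=g_d$. This is an equivalence relation compatible with composition. For $A\in\mathcal A$ let $\dim A$ be the smallest $d\ge 0$ with $A_{d+1}=\Delta^0$. The category $\Theta$ of *generalized simplices* is the full subcategory of $\mathcal A/{\sim}$ on the objects $A$ with $A_n=\Delta^0$ for all $n>\dim A$. Identify $A\in\Theta$ with the presheaf of sets on $\Theta$ that it represents. A *face* of $A$ is a maximal proper subobject $B\hookrightarrow A$ in $\Theta$; the image of the corresponding monomorphism of presheaves, a subpresheaf of $A$, is also called a face. Write $\mathfrak F_A$ for the set of faces of $A$. A face is *inner* if for some $k\in\{1,\dots,\dim A\}$ its $k$-th component $B_k\to A_k$ is an inner face map $\delta_m\colon\Delta^{a-1}\to\Delta^{a}$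 of $\Delta$ (the injection omitting $m$, where $0<m<a$), and *outer* otherwise. For $\Gamma\subseteq\mathfrak F_A$ let $\bigcup\Gamma\subset A$ be the union of the corresponding subpresheaves. An *inner horn* is an inclusion $\bigcup(\mathfrak F_A\setminus\{B\})\subset A$ with $A\in\Theta$ and $B$ an inner face of $A$. A morphism of presheaves of sets on $\Theta$ is an *inner fibration* if it has the right lifting property with respect to all inner horns, and *inner anodyne* if it has the left lifting property with respect to all inner fibrations. **Lemma.** For every generalized simplex $A$ and every proper subset $\Gamma\subsetneq\mathfrak F_A$ containing all outer faces of $A$, the inclusion $\bigcup\Gamma\subset A$ is inner anodyne. -/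

import Mathlib

open CategoryTheory Simplicial

namespace GenSimplex

/-- A morphism of `Δ` is constant if it factors through the point `⦋0⦌`. -/
def IsConstant {X Y : SimplexCategory} (f : X ⟶ Y) : Prop :=
  ∃ (p : X ⟶ ⦋0⦌) (q : ⦋0⦌ ⟶ Y), p ≫ q = f

theorem IsConstant.precomp {X Y Z : SimplexCategory} (f : X ⟶ Y) {g : Y ⟶ Z}
    (hg : IsConstant g) : IsConstant (f ≫ g) := by
  obtain ⟨p, q, rfl⟩ := hg
  exact ⟨f ≫ p, q, by simp⟩

theorem IsConstant.postcomp {X Y Z : SimplexCategory} {f : X ⟶ Y} (hf : IsConstant f)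
    (g : Y ⟶ Z) : IsConstant (f ≫ g) := by
  obtain ⟨p, q, rfl⟩ := hf
  exact ⟨p, q ≫ g, by simp⟩

/-- Sequences of simplices with only finitely many components different from `⦋0⦌`.
Components are indexed from zero: `A n` is the `(n + 1)`-st component of the sequence. -/
def almostAllPoint : ObjectProperty (ℕ → SimplexCategory) :=
  fun A => {n | A n ≠ ⦋0⦌}.Finite

/-- The restricted product of countably many copies of `Δ`, a full subcategory of the product. -/
abbrev RestrictedProduct : Type := almostAllPoint.FullSubcategory

/-- The component of index `n` of a morphism in the restricted product. -/
def component {A B : RestrictedProduct} (f : A ⟶ B) (n : ℕ) : A.obj n ⟶ B.obj n :=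
  f.hom n

@[simp]
theorem component_comp {A B C : RestrictedProduct} (f : A ⟶ B) (g : B ⟶ C) (n : ℕ) :
    component (f ≫ g) n = component f n ≫ component g n := rfl

/-- The least index of a constant component. As components are indexed from zero, the
degree of `f` (the least position, counted from one, of a constant component) is
`degIndex f + 1`. -/
noncomputable def degIndex {A B : RestrictedProduct} (f : A ⟶ B) : ℕ :=
  sInf {n | IsConstant (component f n)}

/-- The number of components before the first one that is equal to `⦋0⦌`. -/
noncomputable def dim (A : RestrictedProduct) : ℕ :=
  sInf {n | A.obj n = ⦋0⦌}

/-- Two parallel morphisms are identified if they have the same degree and agree in all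
components up to and including the first constant one. -/
def agree : HomRel RestrictedProduct := fun _ _ f g =>
  degIndex f = degIndex g ∧ ∀ n ≤ degIndex f, component f n = component g n

theorem isConstant_degIndex {A B : RestrictedProduct} (f : A ⟶ B) :
    IsConstant (component f (degIndex f)) := by
  apply Nat.sInf_mem (s := {n | IsConstant (component f n)})
  obtain ⟨n, hn⟩ := A.property.exists_notMem
  have hn' : A.obj n = ⦋0⦌ := by
    by_contra h
    exact hn h
  exact ⟨n, eqToHom hn', eqToHom hn'.symm ≫ component f n, by simp⟩

theorem degIndex_le {A B : RestrictedProduct} {f : A ⟶ B} {n : ℕ}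
    (h : IsConstant (component f n)) : degIndex f ≤ n := Nat.sInf_le h

/-- Agreement up to one constant component suffices. -/
theorem agree_of_le {A B : RestrictedProduct} {f g : A ⟶ B} {d : ℕ}
    (hf : IsConstant (component f d)) (h : ∀ n ≤ d, component f n = component g n) :
    agree f g := by
  have h1 : degIndex f ≤ d := degIndex_le hf
  have hg : degIndex g ≤ degIndex f :=
    degIndex_le (by rw [← h _ h1]; exact isConstant_degIndex f)
  have hf' : degIndex f ≤ degIndex g :=
    degIndex_le (by rw [h _ (hg.trans h1)]; exact isConstant_degIndex g)
  exact ⟨le_antisymm hf' hg, fun n hn => h n (hn.trans h1)⟩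

/-- The relation `agree` is an equivalence relation compatible with composition, so that the
quotient category below identifies two morphisms if and only if they agree. -/
instance : Congruence agree where
  equivalence :=
    { refl := fun _ => ⟨rfl, fun _ _ => rfl⟩
      symm := fun h => ⟨h.1.symm, fun n hn => (h.2 n (h.1.symm ▸ hn)).symm⟩
      trans := fun h h' =>
        ⟨h.1.trans h'.1, fun n hn => (h.2 n hn).trans (h'.2 n (h.1 ▸ hn))⟩ }
  comp_left f _ _ h :=
    agree_of_le ((isConstant_degIndex _).precomp (component f _))
      (fun n hn => by simp only [component_comp, h.2 n hn])
  comp_right g h :=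
    agree_of_le ((isConstant_degIndex _).postcomp (component g _))
      (fun n hn => by simp only [component_comp, h.2 n hn])

/-- All components after the first `dim A` ones are equal to `⦋0⦌`. -/
def isReduced : ObjectProperty (Quotient agree) :=
  fun A => ∀ n, dim A.as ≤ n → A.as.obj n = ⦋0⦌

/-- The category of generalized simplices. -/
abbrev Simplices : Type := isReduced.FullSubcategory

/-- The underlying sequence of simplices of a generalized simplex. -/
abbrev Simplices.seq (A : Simplices) : RestrictedProduct := A.obj.as

/-- The morphism of generalized simplices represented by a morphism of sequences. -/
def homClass {A B : Simplices} (f : A.seq ⟶ B.seq) : A ⟶ B :=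
  ObjectProperty.homMk ((Quotient.functor agree).map f)

/-- The faces of `A`: its maximal proper subobjects in the category of generalized simplices. -/
def faces (A : Simplices) : Set (Subobject A) := {F | IsCoatom F}

/-- The inner face maps `δ i : ⦋n⦌ ⟶ ⦋n + 1⦌`, `0 < i < n + 1`, of the category `Δ`. -/
inductive classicalInnerFace : MorphismProperty SimplexCategory where
  | intro {n : ℕ} (i : Fin (n + 2)) (h0 : 0 < i) (hn : i < Fin.last (n + 1)) :
    classicalInnerFace (SimplexCategory.δ i)

/-- The inner faces of `A`: those with a component that is an inner face of `Δ`. -/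
def innerFaces (A : Simplices) : Set (Subobject A) :=
  {F | F ∈ faces A ∧ ∃ (B : Simplices) (f : B.seq ⟶ A.seq) (_ : Mono (homClass f)),
    F = Subobject.mk (homClass f) ∧
      ∃ k < dim A.seq, classicalInnerFace (component f k)}

/-- The outer faces of `A`: those which are not inner. -/
def outerFaces (A : Simplices) : Set (Subobject A) := faces A \ innerFaces A

/-- The union, inside the presheaf represented by `A`, of the images of the subobjects in `Γ`. -/
noncomputable def union {A : Simplices} (Γ : Set (Subobject A)) : Subfunctor (yoneda.obj A) :=
  ⨆ F ∈ Γ, Subfunctor.range (yoneda.map F.arrow)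

/-- The inclusions `Λ ⊂ A` of inner horns: `Λ` is the union of all faces of a generalized
simplex `A` except one inner face. -/
inductive innerHornInclusions : MorphismProperty (Simplicesᵒᵖ ⥤ Type) where
  | intro {A : Simplices} (B : Subobject A) (hB : B ∈ innerFaces A) :
    innerHornInclusions (union (faces A \ {B})).ι

/-- Inner fibrations: the right lifting property with respect to all inner horns. -/
def innerFibrations : MorphismProperty (Simplicesᵒᵖ ⥤ Type) := innerHornInclusions.rlp

/-- Inner anodyne maps: the left lifting property with respect to all inner fibrations. -/
def innerAnodyne : MorphismProperty (Simplicesᵒᵖ ⥤ Type) := innerFibrations.llp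

end GenSimplex

namespace GenSimplex

/-! Faces of `A` correspond to face vertices `(k, m)`: vertices of components before the dimension,
where the component has at least three vertices or is the last nontrivial one. A morphism factors
through the face opposite to `(k, m)` exactly when it avoids `(k, m)`: it misses `m` in component
`k`, or is constant in an earlier component, so that component `k` no longer matters
(`IsFaceMap.exists_comp_eq_iff`, `mem_faces_iff`). Inner faces are those with `m` not an end.

Let `M` be the finite nonempty set of vertices of the missing faces, all of them inner; induct on
its size. If `M` is a single vertex, the inclusion is an inner horn. Otherwise choose `b` in `M` and
first glue in the face `B` opposite to `b`. This is a pushout of the inclusion of the part of `B`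
already present, which is a union of faces of `B` missing one inner face fewer
(`IsFaceMap.preimage_unionOfFaces`). Both this step and the remaining inclusion are covered by
induction. -/

/-! ### Constant and injective maps of simplices -/

theorem isConstant_iff {X Y : SimplexCategory} (f : X ⟶ Y) :
    IsConstant f ↔ ∀ x y, f.toOrderHom x = f.toOrderHom y := by
  constructor
  · rintro ⟨p, q, rfl⟩ x y
    have h : p.toOrderHom x = p.toOrderHom y := Subsingleton.elim (α := Fin 1) _ _
    simp [h]
  · intro h
    refine ⟨SimplexCategory.const _ _ 0, SimplexCategory.const _ _ (f.toOrderHom 0), ?_⟩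
    ext x
    simp [h x 0]

theorem isConstant_comp_iff {X Y Z : SimplexCategory} (f : X ⟶ Y) (g : Y ⟶ Z)
    (hg : Function.Injective g.toOrderHom) : IsConstant (f ≫ g) ↔ IsConstant f := by
  simp [isConstant_iff, hg.eq_iff]

/-- Every nonempty set of vertices of a simplex is the image of an injective map. -/
theorem exists_injective_range_eq {Y : SimplexCategory} (T : Set (Fin (Y.len + 1)))
    (hT : T.Nonempty) : ∃ (S : SimplexCategory) (g : S ⟶ Y),
      Function.Injective g.toOrderHom ∧ Set.range g.toOrderHom = T := by
  classical
  obtain ⟨n, hn⟩ : ∃ n, T.toFinset.card = n + 1 :=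
    Nat.exists_eq_succ_of_ne_zero (Finset.card_ne_zero.2 (Set.toFinset_nonempty.2 hT))
  refine ⟨⦋n⦌, SimplexCategory.Hom.mk (T.toFinset.orderEmbOfFin hn).toOrderHom,
    (T.toFinset.orderEmbOfFin hn).injective, ?_⟩
  simp

theorem exists_comp_eq {X S Y : SimplexCategory} (f : X ⟶ Y) (g : S ⟶ Y)
    (hg : Function.Injective g.toOrderHom)
    (h : Set.range f.toOrderHom ⊆ Set.range g.toOrderHom) : ∃ u : X ⟶ S, u ≫ g = f := by
  choose u hu using fun x => h (Set.mem_range_self x)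
  have hmono : StrictMono g.toOrderHom := g.toOrderHom.monotone.strictMono_of_injective hg
  refine ⟨SimplexCategory.Hom.mk ⟨u, fun x y hxy => ?_⟩, ?_⟩
  · rw [← hmono.le_iff_le, hu, hu]
    exact f.toOrderHom.monotone hxy
  · ext x
    exact congrArg Fin.val (hu x)

theorem comp_injective {X S Y : SimplexCategory} {u v : X ⟶ S} {g : S ⟶ Y}
    (hg : Function.Injective g.toOrderHom) (h : u ≫ g = v ≫ g) : u = v := by
  have : Mono g := SimplexCategory.mono_iff_injective.2 hg
  exact (cancel_mono g).1 h

theorem classicalInnerFace_of_range {S Y : SimplexCategory} (g : S ⟶ Y)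
    (hg : Function.Injective g.toOrderHom) (m : Fin (Y.len + 1))
    (hm : Set.range g.toOrderHom = {m}ᶜ) (h0 : 0 < m) (hl : m < Fin.last _) :
    classicalInnerFace g := by
  have hcard : S.len + 1 = Y.len := by
    have h := Set.ncard_range_of_injective hg
    rw [hm, Set.ncard_compl] at h
    simp at h
    omega
  obtain ⟨n, rfl⟩ : ∃ n, S = ⦋n⦌ := ⟨S.len, rfl⟩
  obtain ⟨n', rfl⟩ : ∃ n', Y = ⦋n'⦌ := ⟨Y.len, rfl⟩
  obtain rfl : n + 1 = n' := hcard
  have : Mono g := SimplexCategory.mono_iff_injective.2 hg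
  obtain ⟨i, rfl⟩ := SimplexCategory.eq_δ_of_mono g
  obtain rfl : i = m := by
    have h : i ∉ Set.range (SimplexCategory.δ i).toOrderHom := by
      rintro ⟨x, hx⟩
      exact Fin.succAbove_ne i x hx
    rw [hm] at h
    simpa using h
  exact .intro i h0 hl

theorem classicalInnerFace.exists_notMem {S Y : SimplexCategory} {g : S ⟶ Y}
    (hg : classicalInnerFace g) :
    ∃ m : Fin (Y.len + 1), 0 < m ∧ m < Fin.last _ ∧ m ∉ Set.range g.toOrderHom := by
  obtain ⟨i, h0, hl⟩ := hg
  refine ⟨i, h0, hl, ?_⟩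
  rintro ⟨x, hx⟩
  exact Fin.succAbove_ne i x hx

/-! ### Dimension and representatives of morphisms -/

theorem seq_obj_dim (A : RestrictedProduct) : A.obj (dim A) = ⦋0⦌ := by
  apply Nat.sInf_mem (s := {n | A.obj n = ⦋0⦌})
  obtain ⟨n, hn⟩ := A.property.exists_notMem
  exact ⟨n, by_contra hn⟩

theorem len_pos_of_lt_dim {A : RestrictedProduct} {n : ℕ} (h : n < dim A) :
    0 < (A.obj n).len := by
  by_contra h0
  exact Nat.notMem_of_lt_sInf h (SimplexCategory.ext (y := ⦋0⦌) (by simpa using h0))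

theorem seq_obj_of_dim_le (A : Simplices) {n : ℕ} (h : dim A.seq ≤ n) : A.seq.obj n = ⦋0⦌ :=
  A.property n h

theorem dim_le_iff (A : Simplices) (n : ℕ) : dim A.seq ≤ n ↔ (A.seq.obj n).len = 0 := by
  constructor
  · intro h
    rw [seq_obj_of_dim_le A h]
  · intro h
    by_contra h'
    have := len_pos_of_lt_dim (not_le.1 h')
    omega

theorem homClass_surjective {A B : Simplices} (f : A ⟶ B) :
    ∃ g : A.seq ⟶ B.seq, homClass g = f := by
  obtain ⟨g, hg⟩ := (Quotient.functor agree).map_surjective f.hom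
  exact ⟨g, by ext; exact hg⟩

theorem homClass_eq_iff {A B : Simplices} (f g : A.seq ⟶ B.seq) :
    homClass f = homClass g ↔ agree f g := by
  rw [← Quotient.functor_map_eq_iff agree]
  exact ⟨fun h => congrArg (fun u : A ⟶ B => u.hom) h, fun h => by unfold homClass; rw [h]⟩

theorem homClass_comp {A B C : Simplices} (f : A.seq ⟶ B.seq) (g : B.seq ⟶ C.seq) :
    homClass (f ≫ g) = homClass f ≫ homClass g := rfl

theorem homClass_id (A : Simplices) : homClass (𝟙 A.seq) = 𝟙 A := rfl

/-- A morphism of sequences with prescribed components. -/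
def ofComponents {A B : RestrictedProduct} (f : ∀ n, A.obj n ⟶ B.obj n) : A ⟶ B :=
  ObjectProperty.homMk f

@[simp]
theorem component_id (A : RestrictedProduct) (n : ℕ) : component (𝟙 A) n = 𝟙 _ := rfl

/-- Composing with injective components neither creates nor destroys constancy, so agreement up to
the degree of the composite already suffices. -/
theorem mono_homClass {A B : Simplices} (f : A.seq ⟶ B.seq)
    (hf : ∀ n, Function.Injective (component f n).toOrderHom) : Mono (homClass f) := by
  refine ⟨fun {X} g h hgh => ?_⟩
  obtain ⟨g, rfl⟩ := homClass_surjective g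
  obtain ⟨h, rfl⟩ := homClass_surjective h
  rw [← homClass_comp, ← homClass_comp, homClass_eq_iff] at hgh
  rw [homClass_eq_iff]
  exact agree_of_le ((isConstant_comp_iff _ _ (hf _)).1 (isConstant_degIndex (g ≫ f)))
    fun n hn => comp_injective (hf n) (hgh.2 n hn)

/-! ### Vertices and avoidance -/

/-- A vertex of a component of a generalized simplex. -/
abbrev Vertex (A : Simplices) : Type := Σ k, Fin ((A.seq.obj k).len + 1)

/-- The vertices whose removal leaves a face. -/
def IsFaceVertex {A : Simplices} (i : Vertex A) : Prop :=
  i.1 < dim A.seq ∧ (2 ≤ (A.seq.obj i.1).len ∨ i.1 + 1 = dim A.seq)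

/-- The vertices whose removal leaves an inner face. -/
def IsInnerVertex {A : Simplices} (i : Vertex A) : Prop :=
  i.1 < dim A.seq ∧ 0 < i.2 ∧ i.2 < Fin.last _

theorem IsInnerVertex.isFaceVertex {A : Simplices} {i : Vertex A} (h : IsInnerVertex i) :
    IsFaceVertex i := by
  refine ⟨h.1, Or.inl ?_⟩
  have h1 := Fin.lt_def.1 h.2.1
  have h2 := Fin.lt_def.1 h.2.2
  simp at h1 h2
  omega

/-- The condition for a morphism to factor through the face opposite to the vertex `i`. -/
def Avoids {X A : Simplices} (f : X.seq ⟶ A.seq) (i : Vertex A) : Prop :=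
  (∃ j < i.1, IsConstant (component f j)) ∨ i.2 ∉ Set.range (component f i.1).toOrderHom

theorem Avoids.precomp {X Y A : Simplices} {f : X.seq ⟶ A.seq} {i : Vertex A} (h : Avoids f i)
    (g : Y.seq ⟶ X.seq) : Avoids (g ≫ f) i := by
  rcases h with ⟨j, hj, hc⟩ | h
  · exact Or.inl ⟨j, hj, hc.precomp _⟩
  · refine Or.inr fun hr => h ?_
    obtain ⟨x, hx⟩ := hr
    exact ⟨(component g i.1).toOrderHom x, by simpa using hx⟩

/-- Beyond the common degree avoidance is automatic; up to it the components coincide. -/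
theorem Avoids.of_agree {X A : Simplices} {f g : X.seq ⟶ A.seq} {i : Vertex A} (h : Avoids f i)
    (hfg : agree f g) : Avoids g i := by
  by_cases hd : degIndex f < i.1
  · refine Or.inl ⟨degIndex g, hfg.1 ▸ hd, isConstant_degIndex g⟩
  rcases h with ⟨j, hj, hc⟩ | h
  · exact absurd ((degIndex_le hc).trans_lt hj) hd
  · right
    rwa [← hfg.2 _ (not_lt.1 hd)]

/-- A morphism which avoids no face vertex is a split epimorphism. -/
theorem exists_section {X A : Simplices} (f : X.seq ⟶ A.seq)
    (hf : ∀ i : Vertex A, IsFaceVertex i → ¬ Avoids f i) :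
    ∃ s : A ⟶ X, s ≫ homClass f = 𝟙 A := by
  -- Every vertex of the last nontrivial component is a face vertex, and an earlier constant
  -- component would make `f` avoid all of them.
  have hconst : ∀ j, j + 1 < dim A.seq → ¬ IsConstant (component f j) := fun j hj hc =>
    hf ⟨dim A.seq - 1, 0⟩ ⟨by dsimp; omega, Or.inr (by dsimp; omega)⟩
      (Or.inl ⟨j, by dsimp; omega, hc⟩)
  have hsurj : ∀ j, Function.Surjective (component f j).toOrderHom := by
    intro j m
    by_contra hm
    by_cases hj : j < dim A.seq
    · by_cases h2 : IsFaceVertex (A := A) ⟨j, m⟩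
      · exact hf _ h2 (Or.inr hm)
      -- Here the component has at most two vertices, so missing `m` makes `f` constant there.
      · simp only [IsFaceVertex, not_and_or, not_or, not_le] at h2
        refine hconst j (by omega) ((isConstant_iff _).2 fun x y => ?_)
        have hx : (component f j).toOrderHom x ≠ m := fun h => hm ⟨x, h⟩
        have hy : (component f j).toOrderHom y ≠ m := fun h => hm ⟨y, h⟩
        have hlen : (A.seq.obj j).len < 2 := by tauto
        omega
    · have hlen := (dim_le_iff A j).1 (not_lt.1 hj)
      exact hm ⟨0, by ext; have := ((component f j).toOrderHom 0).2; omega⟩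
  have hs : ∀ j, ∃ s : A.seq.obj j ⟶ X.seq.obj j, s ≫ component f j = 𝟙 _ := fun j => by
    have : Epi (component f j) := SimplexCategory.epi_iff_surjective.2 (hsurj j)
    have := isSplitEpi_of_epi (component f j)
    exact ⟨section_ _, IsSplitEpi.id _⟩
  choose s hs using hs
  refine ⟨homClass (ofComponents s), ?_⟩
  rw [← homClass_comp, ← homClass_id]
  congr 1
  exact ObjectProperty.hom_ext _ (funext hs)

/-! ### Classification of faces by face vertices -/

/-- A morphism of sequences which omits precisely the vertex `i`. -/
structure IsFaceMap {B A : Simplices} (f : B.seq ⟶ A.seq) (i : Vertex A) : Prop where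
  injective : ∀ n, Function.Injective (component f n).toOrderHom
  mem_range_iff : ∀ j : Vertex A, j.2 ∈ Set.range (component f j.1).toOrderHom ↔ j ≠ i

theorem exists_isFaceMap {A : Simplices} (i : Vertex A) (hi : IsFaceVertex i) :
    ∃ (B : Simplices) (f : B.seq ⟶ A.seq), IsFaceMap f i := by
  have hex : ∀ n, ∃ (S : SimplexCategory) (g : S ⟶ A.seq.obj n),
      Function.Injective g.toOrderHom ∧
      Set.range g.toOrderHom = {v | (⟨n, v⟩ : Vertex A) ≠ i} := fun n => by
    apply exists_injective_range_eq
    by_contra hne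
    rw [Set.not_nonempty_iff_eq_empty, Set.eq_empty_iff_forall_notMem] at hne
    simp only [ne_eq, Set.mem_ofPred_eq, not_not] at hne
    have h0 := hne 0
    obtain rfl : n = i.1 := congrArg Sigma.fst h0
    have hlen := len_pos_of_lt_dim hi.1
    have h1 := h0.trans (hne (Fin.last _)).symm
    simp only [Sigma.mk.injEq, heq_eq_eq, true_and] at h1
    have := congrArg Fin.val h1
    simp at this
    omega
  choose S g hg hr using hex
  have hcard : ∀ n, (S n).len + 1 = {v | (⟨n, v⟩ : Vertex A) ≠ i}.ncard := fun n => by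
    rw [← hr, Set.ncard_range_of_injective (hg n)]
    simp
  have hle : ∀ n, (S n).len ≤ (A.seq.obj n).len := fun n => by
    have := SimplexCategory.mono_iff_injective.2 (hg n)
    exact SimplexCategory.len_le_of_mono (g n)
  have hS : ∀ n, dim A.seq ≤ n → S n = ⦋0⦌ := fun n hn => by
    refine SimplexCategory.ext (y := ⦋0⦌) ?_
    have := hle n
    rw [(dim_le_iff A n).1 hn] at this
    exact Nat.le_zero.1 this
  let B' : RestrictedProduct := ⟨S, (Set.finite_lt_nat (dim A.seq)).subset fun n hn => by
    by_contra h
    exact hn (hS n (not_lt.1 h))⟩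
  have hlen : ∀ n, n ≠ i.1 → (S n).len = (A.seq.obj n).len := fun n hn => by
    have : {v | (⟨n, v⟩ : Vertex A) ≠ i} = Set.univ := by
      ext v
      simp only [ne_eq, Set.mem_ofPred_eq, Set.mem_univ, iff_true]
      exact fun h => hn (congrArg Sigma.fst h)
    have h := hcard n
    rw [this, Set.ncard_univ] at h
    simpa using h
  have hB : ∀ n, dim B' ≤ n → B'.obj n = ⦋0⦌ := by
    intro n hn
    -- Removing `i` can lower the dimension only by collapsing component `i.1` to a point. A face
    -- vertex allows this only in the last nontrivial component, where the sequence stays reduced.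
    by_cases hd : dim B' = i.1
    · rcases eq_or_lt_of_le hn with rfl | hlt
      · exact seq_obj_dim B'
      · rcases hi.2 with h2 | h2
        · have h0 : (S i.1).len = 0 := by
            have := seq_obj_dim B'
            rw [hd] at this
            exact congrArg SimplexCategory.len this
          have hc := hcard i.1
          have : {v | (⟨i.1, v⟩ : Vertex A) ≠ i} = {i.2}ᶜ := by
            ext v
            obtain ⟨k, m⟩ := i
            simp
          rw [this, Set.ncard_compl, h0] at hc
          simp at hc
          omega
        · exact hS n (by omega)
    · have h0 := congrArg SimplexCategory.len (seq_obj_dim B')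
      exact hS n (((dim_le_iff A _).2 ((hlen _ hd).symm.trans h0)).trans hn)
  exact ⟨⟨⟨B'⟩, hB⟩, ofComponents (A := B') g, ⟨hg, fun j => by
    change j.2 ∈ Set.range (g j.1).toOrderHom ↔ _
    rw [hr]
    rfl⟩⟩

theorem IsFaceMap.mono {B A : Simplices} {f : B.seq ⟶ A.seq} {i : Vertex A}
    (hf : IsFaceMap f i) : Mono (homClass f) := mono_homClass f hf.injective

theorem IsFaceMap.avoids {B A : Simplices} {f : B.seq ⟶ A.seq} {i : Vertex A}
    (hf : IsFaceMap f i) : Avoids f i := Or.inr fun h => (hf.mem_range_iff i).1 h rfl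

theorem IsFaceMap.exists_comp_eq_iff {B A X : Simplices} {f : B.seq ⟶ A.seq} {i : Vertex A}
    (hf : IsFaceMap f i) (x : X.seq ⟶ A.seq) :
    (∃ y : X ⟶ B, y ≫ homClass f = homClass x) ↔ Avoids x i := by
  constructor
  · rintro ⟨y, hy⟩
    obtain ⟨y, rfl⟩ := homClass_surjective y
    rw [← homClass_comp, homClass_eq_iff] at hy
    exact (hf.avoids.precomp y).of_agree hy
  · intro hx
    -- Lifts are needed only up to the degree of `x`; where no lift exists, a constant map serves as
    -- filler.
    have hex : ∀ n, ∃ y : X.seq.obj n ⟶ B.seq.obj n,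
        Set.range (component x n).toOrderHom ⊆ Set.range (component f n).toOrderHom →
          y ≫ component f n = component x n := fun n => by
      by_cases h : Set.range (component x n).toOrderHom ⊆ Set.range (component f n).toOrderHom
      · obtain ⟨y, hy⟩ := exists_comp_eq _ _ (hf.injective n) h
        exact ⟨y, fun _ => hy⟩
      · exact ⟨SimplexCategory.const _ _ 0, fun h' => absurd h' h⟩
    choose y hy using hex
    refine ⟨homClass (ofComponents y), ?_⟩
    rw [← homClass_comp, homClass_eq_iff]
    have key : ∀ n ≤ degIndex x, component x n = component (ofComponents y ≫ f) n := by
      intro n hn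
      refine (hy n ?_).symm
      rintro _ ⟨v, rfl⟩
      refine (hf.mem_range_iff ⟨n, _⟩).2 ?_
      rintro rfl
      rcases hx with ⟨j, hj, hc⟩ | hx
      · have := degIndex_le hc
        dsimp at hj
        omega
      · exact hx ⟨v, rfl⟩
    have h := agree_of_le (isConstant_degIndex x) key
    exact ⟨h.1.symm, fun n hn => (h.2 n (h.1.symm ▸ hn)).symm⟩

/-- The face of `A` opposite to the vertex `i`. -/
noncomputable def face {A : Simplices} (i : Vertex A) (hi : IsFaceVertex i) : Subobject A :=
  have := (exists_isFaceMap i hi).choose_spec.choose_spec.mono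
  Subobject.mk (homClass (exists_isFaceMap i hi).choose_spec.choose)

theorem face_factors_iff {A X : Simplices} (i : Vertex A) (hi : IsFaceVertex i)
    (x : X.seq ⟶ A.seq) : (face i hi).Factors (homClass x) ↔ Avoids x i := by
  have hf := (exists_isFaceMap i hi).choose_spec.choose_spec
  have := hf.mono
  rw [← hf.exists_comp_eq_iff, face, Subobject.mk_factors_iff]
  rfl

theorem mk_le_face_iff {A B : Simplices} (i : Vertex A) (hi : IsFaceVertex i)
    (f : B.seq ⟶ A.seq) [Mono (homClass f)] :
    Subobject.mk (homClass f) ≤ face i hi ↔ Avoids f i := by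
  rw [← face_factors_iff i hi]
  constructor
  · intro h
    exact Subobject.factors_of_le _ h ((Subobject.mk_factors_iff _ _).2 ⟨𝟙 _, by simp⟩)
  · intro h
    refine Subobject.le_of_comm ((Subobject.underlyingIso _).hom ≫ Subobject.factorThru _ _ h) ?_
    simp

theorem IsFaceMap.mk_eq_face {A B : Simplices} {i : Vertex A} (hi : IsFaceVertex i)
    {f : B.seq ⟶ A.seq} (hf : IsFaceMap f i) [Mono (homClass f)] :
    Subobject.mk (homClass f) = face i hi := by
  refine le_antisymm ((mk_le_face_iff i hi f).2 hf.avoids) ?_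
  have hg := (exists_isFaceMap i hi).choose_spec.choose_spec
  have := hg.mono
  obtain ⟨y, hy⟩ := (hf.exists_comp_eq_iff _).2 hg.avoids
  exact Subobject.mk_le_mk_of_comm y hy

theorem face_ne_top {A : Simplices} (i : Vertex A) (hi : IsFaceVertex i) : face i hi ≠ ⊤ := by
  intro h
  have hid : Avoids (𝟙 A.seq) i := by
    rw [← face_factors_iff i hi, h]
    exact Subobject.top_factors _
  rcases hid with ⟨j, hj, hc⟩ | h
  · have hlen := len_pos_of_lt_dim (hj.trans hi.1)
    have := (isConstant_iff _).1 hc 0 (Fin.last _)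
    simp [Fin.ext_iff] at this
    omega
  · exact h ⟨i.2, by simp⟩

/-- If the inclusion avoided no face vertex, it would have a section by `exists_section`, and `F`
would be everything. -/
theorem exists_le_face {A : Simplices} (F : Subobject A) (hF : F ≠ ⊤) :
    ∃ (i : Vertex A) (hi : IsFaceVertex i), F ≤ face i hi := by
  obtain ⟨f, hf⟩ := homClass_surjective F.arrow
  have hmono : Mono (homClass f) := by rw [hf]; infer_instance
  have hmk : F = Subobject.mk (homClass f) := by
    simp only [hf, Subobject.mk_arrow]
  by_contra! h
  obtain ⟨s, hs⟩ := exists_section f fun i hi ha => h i hi (by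
    rw [hmk]
    exact (mk_le_face_iff i hi f).2 ha)
  apply hF
  rw [hmk, ← top_le_iff, Subobject.top_eq_id]
  exact Subobject.mk_le_mk_of_comm s hs

/-- Makes faces at distinct vertices incomparable: deleting a face vertex leaves at least two
vertices in every component before the last nontrivial one, so no constancy arises early. -/
theorem eq_of_avoids {A B : Simplices} {i j : Vertex A} (hi : IsFaceVertex i)
    (hj : IsFaceVertex j) {f : B.seq ⟶ A.seq} (hf : IsFaceMap f i) (h : Avoids f j) : j = i := by
  by_contra hne
  rcases h with ⟨n, hn, hc⟩ | h
  · have hlen := len_pos_of_lt_dim (hn.trans hj.1)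
    rw [isConstant_iff] at hc
    have key : ∀ u v : Fin ((A.seq.obj n).len + 1), (⟨n, u⟩ : Vertex A) ≠ i →
        (⟨n, v⟩ : Vertex A) ≠ i → u = v := by
      intro u v hu hv
      obtain ⟨x, hx⟩ := (hf.mem_range_iff ⟨n, u⟩).2 hu
      obtain ⟨y, hy⟩ := (hf.mem_range_iff ⟨n, v⟩).2 hv
      exact hx.symm.trans ((hc x y).trans hy)
    obtain ⟨k, m⟩ := i
    by_cases hk : n = k
    · subst hk
      have h2 : 2 ≤ (A.seq.obj n).len := by
        rcases hi.2 with h2 | h2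
        · exact h2
        · have := hj.1
          dsimp at h2
          omega
      obtain ⟨u, v, hu, hv, huv⟩ : ∃ u v : Fin ((A.seq.obj n).len + 1), u ≠ m ∧ v ≠ m ∧ u ≠ v := by
        have hc : 1 < ({m}ᶜ : Finset (Fin ((A.seq.obj n).len + 1))).card := by
          rw [Finset.card_compl]
          simp
          omega
        obtain ⟨u, hu, v, hv, huv⟩ := Finset.one_lt_card.1 hc
        exact ⟨u, v, by simpa using hu, by simpa using hv, huv⟩
      exact huv (key u v (by simpa using hu) (by simpa using hv))
    · have := key 0 (Fin.last _) (fun h => hk (congrArg Sigma.fst h))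
        (fun h => hk (congrArg Sigma.fst h))
      simp [Fin.ext_iff] at this
      omega
  · exact h ((hf.mem_range_iff j).2 hne)

theorem eq_of_face_le {A : Simplices} {i j : Vertex A} (hi : IsFaceVertex i)
    (hj : IsFaceVertex j) (h : face i hi ≤ face j hj) : j = i := by
  obtain ⟨B, f, hf⟩ := exists_isFaceMap i hi
  have := hf.mono
  rw [← hf.mk_eq_face hi, mk_le_face_iff] at h
  exact eq_of_avoids hi hj hf h

theorem face_mem_faces {A : Simplices} (i : Vertex A) (hi : IsFaceVertex i) :
    face i hi ∈ faces A := by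
  refine ⟨face_ne_top i hi, fun G hG => ?_⟩
  by_contra hne
  obtain ⟨j, hj, hle⟩ := exists_le_face G hne
  obtain rfl := eq_of_face_le hi hj (hG.le.trans hle)
  exact absurd hle hG.not_ge

theorem mem_faces_iff {A : Simplices} (F : Subobject A) :
    F ∈ faces A ↔ ∃ (i : Vertex A) (hi : IsFaceVertex i), F = face i hi := by
  constructor
  · intro hF
    obtain ⟨i, hi, hle⟩ := exists_le_face F hF.1
    refine ⟨i, hi, ?_⟩
    rcases eq_or_lt_of_le hle with h | h
    · exact h
    · exact absurd (hF.2 _ h) (face_ne_top i hi)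
  · rintro ⟨i, hi, rfl⟩
    exact face_mem_faces i hi

/-- A representative with an inner face map as a component avoids the omitted inner vertex;
incomparability of faces forces that vertex to be `i`. -/
theorem face_mem_innerFaces_iff {A : Simplices} (i : Vertex A) (hi : IsFaceVertex i) :
    face i hi ∈ innerFaces A ↔ IsInnerVertex i := by
  constructor
  · rintro ⟨-, B, f, _, hF, k, hk, hkf⟩
    obtain ⟨m, h0, hl, hm⟩ := hkf.exists_notMem
    have hj : IsInnerVertex (A := A) ⟨k, m⟩ := ⟨hk, h0, hl⟩
    have hle : face i hi ≤ face ⟨k, m⟩ hj.isFaceVertex := by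
      rw [hF, mk_le_face_iff]
      exact Or.inr hm
    rwa [← eq_of_face_le _ _ hle]
  · intro h
    obtain ⟨B, f, hf⟩ := exists_isFaceMap i hi
    have := hf.mono
    refine ⟨face_mem_faces i hi, B, f, this, (hf.mk_eq_face hi).symm, i.1, h.1, ?_⟩
    refine classicalInnerFace_of_range _ (hf.injective _) i.2 ?_ h.2.1 h.2.2
    ext v
    rw [hf.mem_range_iff ⟨i.1, v⟩]
    obtain ⟨k, m⟩ := i
    simp

/-! ### Unions of faces and gluing -/

/-- The union of two subfunctors one of which is the range of a monomorphism is a pushout. -/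
theorem isPushout_fromPreimage {C : Type*} [Category* C] {F G : C ⥤ Type} (p : G ⟶ F) [Mono p]
    {U V : Subfunctor F} (hUV : U ≤ V) (hp : Subfunctor.range p ≤ V)
    (hV : V ≤ U ⊔ Subfunctor.range p) :
    IsPushout (U.fromPreimage p) (U.preimage p).ι (Subfunctor.homOfLe hUV)
      (Subfunctor.lift p hp) := by
  have hinj (X : C) : Function.Injective (p.app X) := (mono_iff_injective _).1 inferInstance
  have key (X : C) : IsPushout ((U.fromPreimage p).app X) ((U.preimage p).ι.app X)
      ((Subfunctor.homOfLe hUV).app X) ((Subfunctor.lift p hp).app X) := by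
    apply Limits.Types.isPushout_of_isPullback_of_mono'
    · rw [Limits.Types.isPullback_iff]
      refine ⟨rfl, fun x y h => Subtype.ext h.2, fun (x : U.obj X) y h => ?_⟩
      have h' : (x : F.obj X) = p.app X y := congrArg Subtype.val h
      exact ⟨⟨y, Set.mem_preimage.2 (h' ▸ x.2)⟩, Subtype.ext h'.symm, rfl⟩
    · refine Set.eq_univ_of_forall fun (⟨x, hx⟩ : V.obj X) => ?_
      rcases hV X hx with h | ⟨y, rfl⟩
      · exact Or.inl ⟨⟨x, h⟩, rfl⟩
      · exact Or.inr ⟨y, rfl⟩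
    · intro x y _ _ h
      exact hinj X (congrArg Subtype.val h)
  exact ⟨⟨rfl⟩, ⟨Limits.evaluationJointlyReflectsColimits _ fun X =>
    (Limits.PushoutCocone.isColimitMapCoconeEquiv _ _).2 (key X).isColimit⟩⟩

theorem avoids_iff_of_homClass_eq {X A : Simplices} {f g : X.seq ⟶ A.seq} (i : Vertex A)
    (h : homClass f = homClass g) : Avoids f i ↔ Avoids g i := by
  rw [homClass_eq_iff] at h
  exact ⟨fun hf => hf.of_agree h, fun hg => hg.of_agree ((Congruence.equivalence).symm h)⟩

/-- The union of the faces of `A` opposite to the face vertices not in `M`. -/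
def unionOfFaces (A : Simplices) (M : Set (Vertex A)) : Subfunctor (yoneda.obj A) where
  obj X := {x | ∃ (f : X.unop.seq ⟶ A.seq) (i : Vertex A), homClass f = x ∧
    IsFaceVertex i ∧ i ∉ M ∧ Avoids f i}
  map {X Y} g := by
    rintro _ ⟨f, i, rfl, hi, hM, hf⟩
    obtain ⟨g', hg'⟩ := homClass_surjective g.unop
    exact ⟨g' ≫ f, i, by rw [homClass_comp, hg']; rfl, hi, hM, hf.precomp g'⟩

theorem homClass_mem_unionOfFaces_iff {A X : Simplices} (M : Set (Vertex A))
    (f : X.seq ⟶ A.seq) : homClass f ∈ (unionOfFaces A M).obj (Opposite.op X) ↔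
      ∃ i : Vertex A, IsFaceVertex i ∧ i ∉ M ∧ Avoids f i := by
  constructor
  · rintro ⟨g, i, hg, hi, hM, h⟩
    exact ⟨i, hi, hM, (avoids_iff_of_homClass_eq i hg).1 h⟩
  · rintro ⟨i, hi, hM, h⟩
    exact ⟨f, i, rfl, hi, hM, h⟩

theorem union_eq_unionOfFaces {A : Simplices} (Γ : Set (Subobject A)) (M : Set (Vertex A))
    (hΓ : Γ ⊆ faces A) (hM : ∀ (i : Vertex A) (hi : IsFaceVertex i), i ∈ M ↔ face i hi ∉ Γ) :
    union Γ = unionOfFaces A M := by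
  ext ⟨X⟩ x
  obtain ⟨f, rfl⟩ := homClass_surjective x
  rw [homClass_mem_unionOfFaces_iff]
  have : homClass f ∈ (union Γ).obj (Opposite.op X) ↔ ∃ F ∈ Γ, F.Factors (homClass f) := by
    simp only [union, Subfunctor.iSup_obj, Set.mem_iUnion, exists_prop]
    exact exists_congr fun F => and_congr_right fun _ =>
      ⟨fun ⟨y, hy⟩ => (Subobject.factors_iff _ _).2 ⟨y, hy⟩, fun h => ⟨F.factorThru _ h, by simp⟩⟩
  rw [this]
  constructor
  · rintro ⟨F, hF, h⟩
    obtain ⟨i, hi, rfl⟩ := (mem_faces_iff F).1 (hΓ hF)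
    exact ⟨i, hi, fun h' => (hM i hi).1 h' hF, (face_factors_iff i hi f).1 h⟩
  · rintro ⟨i, hi, hiM, h⟩
    exact ⟨face i hi, by_contra fun h' => hiM ((hM i hi).2 h'), (face_factors_iff i hi f).2 h⟩

/-! ### Restriction to an inner face -/

/-- The map on vertices induced by a morphism of sequences. -/
def vertexMap {B A : Simplices} (f : B.seq ⟶ A.seq) (i : Vertex B) : Vertex A :=
  ⟨i.1, (component f i.1).toOrderHom i.2⟩

namespace IsFaceMap

variable {A B : Simplices} {f : B.seq ⟶ A.seq} {b : Vertex A}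

theorem vertexMap_injective (hf : IsFaceMap f b) : Function.Injective (vertexMap f) := by
  rintro ⟨k, m⟩ ⟨k', m'⟩ h
  obtain rfl : k = k' := congrArg Sigma.fst h
  simp only [vertexMap, Sigma.mk.injEq, heq_eq_eq, true_and] at h
  rw [hf.injective k h]

theorem vertexMap_ne (hf : IsFaceMap f b) (i : Vertex B) : vertexMap f i ≠ b :=
  (hf.mem_range_iff (vertexMap f i)).1 ⟨i.2, rfl⟩

theorem exists_vertexMap_eq (hf : IsFaceMap f b) {j : Vertex A} (hj : j ≠ b) :
    ∃ i, vertexMap f i = j := by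
  obtain ⟨v, hv⟩ := (hf.mem_range_iff j).2 hj
  exact ⟨⟨j.1, v⟩, by simp [vertexMap, hv]⟩

theorem avoids_comp_iff (hf : IsFaceMap f b) {X : Simplices} (x : X.seq ⟶ B.seq) (i : Vertex B) :
    Avoids (x ≫ f) (vertexMap f i) ↔ Avoids x i := by
  simp only [Avoids, vertexMap, component_comp, isConstant_comp_iff _ _ (hf.injective _)]
  refine or_congr_right (not_congr ?_)
  exact ⟨fun ⟨v, hv⟩ => ⟨v, hf.injective _ hv⟩, fun ⟨v, hv⟩ =>
    ⟨v, congrArg (component f i.1).toOrderHom hv⟩⟩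

theorem len_le (hf : IsFaceMap f b) (n : ℕ) : (B.seq.obj n).len ≤ (A.seq.obj n).len := by
  have := SimplexCategory.mono_iff_injective.2 (hf.injective n)
  exact SimplexCategory.len_le_of_mono (component f n)

theorem component_zero (hf : IsFaceMap f b) (hb : IsInnerVertex b) (n : ℕ) :
    (component f n).toOrderHom 0 = 0 := by
  obtain ⟨v, hv⟩ := (hf.mem_range_iff ⟨n, 0⟩).2 (by rintro rfl; exact absurd hb.2.1 (lt_irrefl _))
  refine le_antisymm ?_ (Fin.zero_le _)
  rw [← show _ = (0 : Fin _) from hv]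
  exact (component f n).toOrderHom.monotone (Fin.zero_le _)

theorem component_last (hf : IsFaceMap f b) (hb : IsInnerVertex b) (n : ℕ) :
    (component f n).toOrderHom (Fin.last _) = Fin.last _ := by
  obtain ⟨v, hv⟩ := (hf.mem_range_iff ⟨n, Fin.last _⟩).2
    (by rintro rfl; exact absurd hb.2.2 (lt_irrefl _))
  refine le_antisymm (Fin.le_last _) ?_
  rw [← show _ = Fin.last _ from hv]
  exact (component f n).toOrderHom.monotone (Fin.le_last _)

/-- Removing an inner vertex keeps both ends of every component, so no component collapses to a
point. -/
theorem dim_eq (hf : IsFaceMap f b) (hb : IsInnerVertex b) : dim B.seq = dim A.seq := by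
  apply eq_of_forall_ge_iff
  intro n
  rw [dim_le_iff, dim_le_iff]
  constructor
  · intro h
    have h0 := hf.component_zero hb n
    have h1 := hf.component_last hb n
    have : Fin.last (B.seq.obj n).len = 0 := by ext; simpa using h
    rw [this, h0] at h1
    simpa using (congrArg Fin.val h1).symm
  · intro h
    exact Nat.le_zero.1 (h ▸ hf.len_le n)

theorem isInnerVertex_of_vertexMap (hf : IsFaceMap f b) (hb : IsInnerVertex b) {i : Vertex B}
    (hi : IsInnerVertex (vertexMap f i)) : IsInnerVertex i := by
  obtain ⟨h, h0, hl⟩ := hi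
  refine ⟨(hf.dim_eq hb).symm ▸ h, ?_, ?_⟩
  · rw [Fin.pos_iff_ne_zero]
    intro h'
    apply h0.ne'
    simp only [vertexMap, h']
    exact hf.component_zero hb _
  · rw [Fin.lt_last_iff_ne_last]
    intro h'
    apply hl.ne
    simp only [vertexMap, h']
    exact hf.component_last hb _

/-- The subtlety is that a face vertex of `A` may cease to be one in `B`, when its component shrinks
to two vertices. Avoiding it then forces a constant component, hence membership in an outer face of
`B`, which is always present. -/
theorem preimage_unionOfFaces (hf : IsFaceMap f b) (hb : IsInnerVertex b) (M : Set (Vertex A))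
    (hbM : b ∈ M) (hM : ∀ i ∈ M, IsInnerVertex i) :
    (unionOfFaces A M).preimage (yoneda.map (homClass f)) =
      unionOfFaces B (vertexMap f ⁻¹' M) := by
  ext ⟨X⟩ x
  obtain ⟨x, rfl⟩ := homClass_surjective x
  rw [homClass_mem_unionOfFaces_iff]
  refine (homClass_mem_unionOfFaces_iff M (x ≫ f)).trans ?_
  have hdim := hf.dim_eq hb
  constructor
  · rintro ⟨j, hj, hjM, h⟩
    obtain ⟨i, rfl⟩ := hf.exists_vertexMap_eq (j := j) (by rintro rfl; exact hjM hbM)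
    rw [hf.avoids_comp_iff] at h
    by_cases hi : IsFaceVertex i
    · exact ⟨i, hi, hjM, h⟩
    · have hlt : i.1 < dim A.seq := hj.1
      simp only [IsFaceVertex, hdim, not_and_or, not_or, not_le, not_lt, hlt.not_ge,
        false_or] at hi
      have hc : ∃ n ≤ i.1, IsConstant (component x n) := by
        rcases h with ⟨n, hn, hc⟩ | h
        · exact ⟨n, hn.le, hc⟩
        · refine ⟨i.1, le_rfl, (isConstant_iff _).2 fun u v => ?_⟩
          have hu : (component x i.1).toOrderHom u ≠ i.2 := fun h' => h ⟨u, h'⟩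
          have hv : (component x i.1).toOrderHom v ≠ i.2 := fun h' => h ⟨v, h'⟩
          omega
      obtain ⟨n, hn, hc⟩ := hc
      -- Component `i.1` is not the last nontrivial one, so `n < dim A.seq - 1`; the vertex `0` is
      -- not inner and so lies outside the preimage of `M`.
      refine ⟨⟨dim A.seq - 1, 0⟩, ⟨by dsimp; omega, Or.inr (by dsimp; omega)⟩, fun h0 => ?_,
        Or.inl ⟨n, by dsimp; omega, hc⟩⟩
      exact absurd (hf.isInnerVertex_of_vertexMap hb (hM _ h0)).2.1 (lt_irrefl _)
  · rintro ⟨i, hi, hiM, h⟩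
    refine ⟨vertexMap f i, ⟨hdim ▸ hi.1, ?_⟩, hiM, (hf.avoids_comp_iff x i).2 h⟩
    exact hi.2.imp (fun h2 => h2.trans (hf.len_le i.1)) fun h2 => h2.trans hdim

end IsFaceMap

/-! ### Induction on the number of missing faces -/

theorem innerAnodyne_unionOfFaces (n : ℕ) : ∀ (A : Simplices) (M : Finset (Vertex A)),
    M.card = n + 1 → (∀ i ∈ M, IsInnerVertex i) → innerAnodyne (unionOfFaces A M).ι := by
  classical
  induction n with
  | zero =>
    intro A M hcard hM
    obtain ⟨b, rfl⟩ := Finset.card_eq_one.1 hcard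
    have hb := hM b (by simp)
    have hbf := hb.isFaceVertex
    rw [← union_eq_unionOfFaces (faces A \ {face b hbf}) _ Set.sdiff_subset]
    · exact MorphismProperty.le_llp_rlp _ _
        (.intro _ ((face_mem_innerFaces_iff b hbf).2 hb))
    · intro i hi
      simp only [Finset.coe_singleton, Set.mem_singleton_iff, Set.mem_sdiff, face_mem_faces,
        true_and, not_not]
      exact ⟨fun h => by subst h; rfl, fun h => (eq_of_face_le hi hbf h.le).symm⟩
  | succ n ih =>
    intro A M hcard hM
    obtain ⟨b, M', hbM', rfl, hcard'⟩ := Finset.card_eq_succ.1 hcard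
    have hb := hM b (by simp)
    have hM' : ∀ i ∈ M', IsInnerVertex i := fun i hi => hM i (by simp [hi])
    obtain ⟨B, f, hf⟩ := exists_isFaceMap b hb.isFaceVertex
    have := hf.mono
    -- Vertices of `B` are those of `A` other than `b`, so `N` is a copy of `M'` and induction
    -- applies to `B`.
    let N : Finset (Vertex B) := M'.preimage (vertexMap f) hf.vertexMap_injective.injOn
    have hN : vertexMap f ⁻¹' (insert b M' : Finset (Vertex A)) = (N : Set (Vertex B)) := by
      ext i
      simp [N, hf.vertexMap_ne]
    have hNcard : N.card = n + 1 := by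
      rw [← hcard', Finset.card_preimage, Finset.filter_true_of_mem]
      intro j hj
      exact hf.exists_vertexMap_eq (by rintro rfl; exact hbM' hj)
    have hUV : unionOfFaces A (insert b M' : Finset (Vertex A)) ≤ unionOfFaces A M' := by
      rintro X _ ⟨g, i, rfl, hi, hiM, h⟩
      exact ⟨g, i, rfl, hi, fun h' => hiM (by simp [Finset.mem_coe.1 h']), h⟩
    have hp : Subfunctor.range (yoneda.map (homClass f)) ≤ unionOfFaces A M' := by
      rintro ⟨X⟩ x ⟨y, rfl⟩
      obtain ⟨y, rfl⟩ := homClass_surjective y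
      exact ⟨y ≫ f, b, rfl, hb.isFaceVertex, hbM', hf.avoids.precomp y⟩
    have hV : unionOfFaces A M' ≤ unionOfFaces A (insert b M' : Finset (Vertex A)) ⊔
        Subfunctor.range (yoneda.map (homClass f)) := by
      rintro ⟨X⟩ _ ⟨g, i, rfl, hi, hiM, h⟩
      by_cases hib : i = b
      · subst hib
        exact Or.inr ((hf.exists_comp_eq_iff g).2 h)
      · exact Or.inl ⟨g, i, rfl, hi, by simpa [hib] using hiM, h⟩
    have hpre := ih B N hNcard fun i hi =>
      hf.isInnerVertex_of_vertexMap hb (hM' _ (by simpa [N] using hi))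
    rw [← hN, ← hf.preimage_unionOfFaces hb _ (by simp) (by simpa using hM)] at hpre
    rw [← Subfunctor.homOfLe_ι hUV]
    refine MorphismProperty.comp_mem innerFibrations.llp _ _ ?_ (ih A M' hcard' hM')
    exact MorphismProperty.of_isPushout (P := innerFibrations.llp)
      (isPushout_fromPreimage (yoneda.map (homClass f)) hUV hp hV) hpre

theorem finite_isFaceVertex (A : Simplices) : {i | IsFaceVertex (A := A) i}.Finite := by
  refine ((Set.finite_lt_nat (dim A.seq)).biUnion fun k _ =>
    Set.finite_range (Sigma.mk k : _ → Vertex A)).subset fun i hi => ?_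
  exact Set.mem_biUnion (x := i.1) hi.1 ⟨i.2, rfl⟩

end GenSimplex

theorem mainTheorem5 (A : GenSimplex.Simplices) (Γ : Set (CategoryTheory.Subobject A))
    (hΓ : Γ ⊂ GenSimplex.faces A) (hout : GenSimplex.outerFaces A ⊆ Γ) :
    GenSimplex.innerAnodyne (GenSimplex.union Γ).ι := by
  have hfin : {i |
      ∃ hi : GenSimplex.IsFaceVertex (A := A) i, GenSimplex.face i hi ∉ Γ}.Finite :=
    (GenSimplex.finite_isFaceVertex A).subset fun i hi => hi.1
  have hmem : ∀ i, i ∈ hfin.toFinset ↔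
      ∃ hi : GenSimplex.IsFaceVertex i, GenSimplex.face i hi ∉ Γ := fun i => by simp
  rw [GenSimplex.union_eq_unionOfFaces Γ (hfin.toFinset : Set (GenSimplex.Vertex A)) hΓ.subset
    fun i hi => (hmem i).trans ⟨fun h => h.2, fun h => ⟨hi, h⟩⟩]
  obtain ⟨F, hF, hFΓ⟩ := Set.exists_of_ssubset hΓ
  obtain ⟨i, hi, rfl⟩ := (GenSimplex.mem_faces_iff F).1 hF
  obtain ⟨n, hn⟩ := Nat.exists_eq_succ_of_ne_zero
    (Finset.card_ne_zero_of_mem ((hmem i).2 ⟨hi, hFΓ⟩))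
  refine GenSimplex.innerAnodyne_unionOfFaces n A _ hn fun j hj => ?_
  obtain ⟨hj, hjΓ⟩ := (hmem j).1 hj
  rw [← GenSimplex.face_mem_innerFaces_iff j hj]
  -- A missing face that is not inner would be outer, hence in `Γ`.
  by_contra h
  exact hjΓ (hout ⟨GenSimplex.face_mem_faces j hj, h⟩)
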